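/- For a finite graph $G$ with vertex set $V$ and a real number $x$, let $\mathcal C_x$ be the class of graphs in which every connected component has at most $x$ vertices, and let $$\nu(G,\mathcal C_x)=\frac{1}{|V|}\max\{|S| : S\subseteq V,\ G[S]\in\mathcal C_x\},$$ where $G[S]$ is the subgraph of $G$ induced by $S$ (the empty graph belongs to $\mathcal C_x$). Let $\mathcal G(n,c/n)$ be the random graph on $\{1,\dots,n\}$ in which each pair of vertices is joined independently with probability $c/n$, and let $\mathcal G_d(n)$ be the uniformly random $d$-regular graph on $\{1,\dots,n\}$ (with $nd$ even). **Theorem 1.** Let a real number $c>1$, an integer $d\ge 3$ and a real number $\epsilon>0$ be given. Then there exists $\delta>0$ such that, if $G\in\mathcal G(n,c/n)$, or if $G\in\mathcal G_d(n)$, then $$\nu(G,\mathcal C_{\delta n})\le \nu(G,\mathcal C_{1/\delta})+\epsilon$$ holds with high probability, that is, with probability tending to $1$ as $n\to\infty$ (in the case of $\mathcal G_d(n)$, as $n\to\infty$ through the integers for which $nd$ is even). -/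

import Mathlib

namespace Dismantling

/-- A class of graphs: a property of graphs on arbitrary vertex types. -/
abbrev GraphClass : Type 1 := ∀ V : Type, SimpleGraph V → Prop

/-- The class `C_x` of graphs all of whose (connected) components have at most `x` vertices,
for a real number `x`. -/
def componentsAtMost (x : ℝ) : GraphClass := fun _ G =>
  ∀ C : G.ConnectedComponent, C.supp.Finite ∧ (C.supp.ncard : ℝ) ≤ x

open Classical in
/-- `N(G, Γ)`: the largest size of a vertex set `S` such that the induced subgraph `G[S]` belongs
to `Γ`; it is `0` if no induced subgraph belongs to `Γ`. -/
noncomputable def maxInduced {V : Type} [Fintype V] (G : SimpleGraph V) (Γ : GraphClass) : ℕ :=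
  (Finset.univ.filter fun S : Finset V => Γ (S : Set V) (G.induce (S : Set V))).sup Finset.card

/-- `ν(G, Γ) = N(G, Γ) / |G|`. -/
noncomputable def nu {V : Type} [Fintype V] (G : SimpleGraph V) (Γ : GraphClass) : ℝ :=
  (maxInduced G Γ : ℝ) / (Fintype.card V : ℝ)

/-- The law of the random graph `G(n, c/n)` on `n` labelled vertices. The edge probability `c/n` is
truncated to `[0, 1]`, which for `c ≥ 0` matters only for the finitely many `n < c`
(and for `n = 0`). -/
noncomputable def gnpLaw (c : ℝ) (n : ℕ) : MeasureTheory.Measure (SimpleGraph (Fin n)) :=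
  SimpleGraph.binomialRandom (Fin n) (Set.projIcc (0 : ℝ) 1 zero_le_one (c / n))

open Classical in
/-- The law of the uniform random `d`-regular graph on `n` labelled vertices. -/
noncomputable def regularLaw (d n : ℕ) : MeasureTheory.Measure (SimpleGraph (Fin n)) :=
  ProbabilityTheory.uniformOn {G : SimpleGraph (Fin n) | G.IsRegularOfDegree d}

/-- The set of graphs `G` on `n` labelled vertices with
`ν(G, C_{δ n}) ≤ ν(G, C_{1/δ}) + ε`. -/
def goodGraphs (δ ε : ℝ) (n : ℕ) : Set (SimpleGraph (Fin n)) :=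
  {G | nu G (componentsAtMost (δ * n)) ≤ nu G (componentsAtMost (1 / δ)) + ε}

end Dismantling

/-!
Let `W` be a component of `G[S]`, where `G` is one of the random graphs and all components of `G[S]`
have at most `δ n` vertices. Small sets in a sparse random graph are nearly trees: with high
probability every set of `k ≤ δ n` vertices spans fewer than `k + k / K + 1` edges
(`LocallySparse`). So a component `W` with `k > K` vertices has at most `k / K + 1 ≤ 2 k / K` edges
outside a spanning tree. Deleting an endpoint of each of them leaves a forest, and a forest on `k`
vertices breaks into pieces with at most `K` vertices once a further `k / (K + 1)` vertices are
deleted (`SimpleGraph.IsAcyclic.exists_breaking_set`). Treating all large components in this way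
costs at most `3 n / K ≤ ε n` vertices (`LocallySparse.exists_reduction`), which is the claim.
Subsets with small components are handled through their connected subsets
(`componentsAtMost_induce_iff`), which avoids graphs on nested subtypes.

Local sparsity is a first moment estimate (`measure_not_locallySparse_le`) that needs only one fact
about the model: a given set `F` of at most `n / 4` edges is present with probability at most
`(C / n) ^ |F|`. For `G(n, c / n)` this is independence. For random regular graphs it follows, one
edge at a time, by switching (`card_regularContaining_insert_le`): if `uv` is an edge of `G`, then
for at least half of the `n d` oriented edges `xy` the edges `uv`, `xy` can be replaced by `ux`, `vy`
without changing the degrees or touching the rest of `F`, while a graph arises in this way from at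
most `d ^ 2` pairs `(G, xy)`. Since the uniform law on an empty set is `0` rather than a probability
measure, the existence of regular graphs has to be proved too (`exists_isRegularOfDegree`).
-/

namespace Dismantling

/-! ### Breaking sparse graphs into small pieces -/

section Deterministic

variable {V : Type*} {G : SimpleGraph V}

lemma subset_or_subset_of_preconnected {T A B : Set V} (hT : (G.induce T).Preconnected)
    (hTAB : T ⊆ A ∪ B) (hAB : ∀ a ∈ A, ∀ b ∈ B, ¬ G.Adj a b) : T ⊆ A ∨ T ⊆ B := by
  by_contra! h
  obtain ⟨hA, hB⟩ := h
  obtain ⟨y, hyT, hyA⟩ := Set.not_subset.1 hA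
  obtain ⟨x, hxT, hxB⟩ := Set.not_subset.1 hB
  have hxA : x ∈ A := (hTAB hxT).resolve_right hxB
  have key : ∀ u v : T, (G.induce T).Walk u v → (u : V) ∈ A → (v : V) ∈ A := by
    intro u v p
    induction p with
    | nil => exact id
    | cons huv _ ih =>
      intro hu
      refine ih ((hTAB (Subtype.property _)).resolve_right fun hv => ?_)
      exact hAB _ hu _ hv huv
  obtain ⟨p⟩ := hT ⟨x, hxT⟩ ⟨y, hyT⟩
  exact hyA (key _ _ p hxA)

/-- In a forest, a vertex outside a connected set has at most one neighbour in it. -/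
lemma _root_.SimpleGraph.IsAcyclic.eq_of_adj_of_adj (hG : G.IsAcyclic) {C : Set V}
    (hC : (G.induce C).Preconnected) {v a b : V} (hv : v ∉ C) (ha : a ∈ C) (hb : b ∈ C)
    (hva : G.Adj v a) (hvb : G.Adj v b) : a = b := by
  by_contra hab
  have hbr := SimpleGraph.isBridge_iff.1 (SimpleGraph.isAcyclic_iff_forall_adj_isBridge.1 hG hva)
  apply hbr
  let f : G.induce C →g G.deleteEdges {s(v, a)} :=
    { toFun := Subtype.val
      map_rel' := by
        rintro ⟨x, hx⟩ ⟨y, hy⟩ hxy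
        rw [SimpleGraph.deleteEdges_adj]
        refine ⟨hxy, fun h => ?_⟩
        simp only [Set.mem_singleton_iff, Sym2.eq_iff] at h
        rcases h with ⟨rfl, _⟩ | ⟨_, rfl⟩
        · exact hv hx
        · exact hv hy }
  have h1 : (G.deleteEdges {s(v, a)}).Reachable b a := (hC ⟨b, hb⟩ ⟨a, ha⟩).map f
  have h2 : (G.deleteEdges {s(v, a)}).Adj v b := by
    rw [SimpleGraph.deleteEdges_adj]
    refine ⟨hvb, fun h => ?_⟩
    simp only [Set.mem_singleton_iff, Sym2.eq_iff] at h
    rcases h with ⟨_, h⟩ | ⟨_, h⟩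
    · exact hab h.symm
    · exact hvb.ne h.symm
  exact h2.reachable.trans h1

variable [DecidableEq V]

/-- Every connected subset of a finite set `S` extends to a connected component of `G[S]`. -/
lemma exists_component {S T : Finset V} (hTS : T ⊆ S) (hT : (G.induce (T : Set V)).Connected) :
    ∃ C : Finset V, T ⊆ C ∧ C ⊆ S ∧ (G.induce (C : Set V)).Connected ∧
      ∀ a ∈ C, ∀ b ∈ S \ C, ¬ G.Adj a b := by
  classical
  obtain ⟨C, hC, hmax⟩ := Finset.exists_max_image
    (S.powerset.filter fun C => T ⊆ C ∧ (G.induce (C : Set V)).Connected) Finset.card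
    ⟨T, by simp [hTS, hT]⟩
  simp only [Finset.mem_filter, Finset.mem_powerset] at hC hmax
  refine ⟨C, hC.2.1, hC.1, hC.2.2, fun a ha b hb hab => ?_⟩
  obtain ⟨hbS, hbC⟩ := Finset.mem_sdiff.1 hb
  have h1 : (G.induce ((C : Set V) ∪ {a, b})).Connected :=
    SimpleGraph.induce_union_connected hC.2.2.preconnected
      (SimpleGraph.induce_pair_connected_of_adj hab).preconnected ⟨a, by simp [ha]⟩
  have h2 : (C : Set V) ∪ {a, b} = ((insert b C : Finset V) : Set V) := by
    ext x; simp only [Set.mem_union, Set.mem_insert_iff, Set.mem_singleton_iff, Finset.mem_coe,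
      Finset.coe_insert]
    constructor
    · rintro (h | rfl | rfl) <;> simp_all
    · rintro (rfl | h) <;> simp_all
  rw [h2] at h1
  have := hmax (insert b C) ⟨Finset.insert_subset hbS hC.1,
    hC.2.1.trans (Finset.subset_insert _ _), h1⟩
  rw [Finset.card_insert_of_notMem hbC] at this
  omega

/-- A forest is broken into pieces with at most `K` vertices by deleting at most a fraction
`1 / (K + 1)` of the vertices. -/
lemma _root_.SimpleGraph.IsAcyclic.exists_breaking_set (hG : G.IsAcyclic) (K : ℕ) (W : Finset V) :
    ∃ R ⊆ W, (K + 1) * R.card ≤ W.card ∧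
      ∀ T ⊆ W \ R, (G.induce (T : Set V)).Connected → T.card ≤ K := by
  classical
  induction hk : W.card using Nat.strong_induction_on generalizing W with
  | _ k ih =>
  subst hk
  by_cases hW : W.card ≤ K
  · exact ⟨∅, by simp, by simp, fun T hT _ =>
      (Finset.card_le_card (by simpa using hT)).trans hW⟩
  push Not at hW
  -- `B` plays the part of the subtree below its root `v`; a smallest one with more than `K`
  -- vertices falls into small pieces when `v` is deleted.
  let P : V × Finset V → Prop := fun p =>
    p.1 ∈ p.2 ∧ K < p.2.card ∧ ∀ a ∈ p.2.erase p.1, ∀ b ∈ W \ p.2, ¬ G.Adj a b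
  obtain ⟨v₀, hv₀⟩ : W.Nonempty := Finset.card_pos.1 (by omega)
  obtain ⟨⟨v, B⟩, hB, hmin⟩ := Finset.exists_min_image
    ((W ×ˢ W.powerset).filter P) (fun p => p.2.card) ⟨(v₀, W), by
      simp only [P, Finset.mem_filter, Finset.mem_product, Finset.mem_powerset, Finset.sdiff_self]
      exact ⟨⟨hv₀, subset_rfl⟩, hv₀, hW, by simp⟩⟩
  simp only [P, Finset.mem_filter, Finset.mem_product, Finset.mem_powerset] at hB hmin
  obtain ⟨⟨hvW, hBW⟩, hvB, hKB, hsep⟩ := hB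
  have hsmall : ∀ T ⊆ B.erase v, (G.induce (T : Set V)).Connected → T.card ≤ K := by
    intro T hT hTc
    obtain ⟨C, hTC, hCB, hCc, hCsep⟩ := exists_component hT hTc
    by_contra! hTK
    have hCK : K < C.card := hTK.trans_le (Finset.card_le_card hTC)
    have hvC : v ∉ C := fun h => by simpa using hCB h
    have hCB' : C ⊆ B := hCB.trans (Finset.erase_subset _ _)
    have hlt : C.card < B.card :=
      Finset.card_lt_card ⟨hCB', fun h => hvC (h hvB)⟩
    -- the root of `C` is its neighbour of `v`, or any vertex if there is none
    obtain ⟨u, huC, hu⟩ : ∃ u ∈ C, ∀ a ∈ C, G.Adj v a → a = u := by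
      by_cases h : ∃ u ∈ C, G.Adj v u
      · obtain ⟨u, huC, hu⟩ := h
        exact ⟨u, huC, fun a ha hva => hG.eq_of_adj_of_adj hCc.preconnected (by simpa using hvC)
          (by simpa using ha) (by simpa using huC) hva hu⟩
      · push Not at h
        obtain ⟨u, huC⟩ : C.Nonempty := Finset.card_pos.1 (by omega)
        exact ⟨u, huC, fun a ha hva => absurd hva (h a ha)⟩
    have := hmin (u, C) ⟨⟨hBW (hCB' huC), hCB'.trans hBW⟩, huC, hCK, ?_⟩
    · simp only at this; omega
    · intro a ha b hb hab
      obtain ⟨hau, haC⟩ := Finset.mem_erase.1 ha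
      obtain ⟨hbW, hbC⟩ := Finset.mem_sdiff.1 hb
      by_cases hbv : b = v
      · subst hbv; exact hau (hu a haC hab.symm)
      by_cases hbB : b ∈ B
      · exact hCsep a haC b (by simp [hbv, hbB, hbC]) hab
      · exact hsep a (hCB haC) b (by simp [hbW, hbB]) hab
  obtain ⟨R, hRW, hRc, hR⟩ := ih (W \ B).card
    (Finset.card_lt_card ⟨Finset.sdiff_subset, fun h => by simpa [hvB] using h hvW⟩) (W \ B) rfl
  have hcard := Finset.card_sdiff_add_card_eq_card hBW
  refine ⟨insert v R, Finset.insert_subset hvW (hRW.trans Finset.sdiff_subset), ?_, ?_⟩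
  · have := Finset.card_insert_le v R
    nlinarith
  · intro T hT hTc
    have hT' : (T : Set V) ⊆ (B.erase v : Finset V) ∪ ((W \ B) \ R : Finset V) := by
      intro x hx
      have := hT hx
      simp only [Finset.mem_sdiff, Finset.mem_insert, not_or] at this
      by_cases hxB : x ∈ B <;> simp [hxB, this]
    rcases subset_or_subset_of_preconnected hTc.preconnected hT' (fun a ha b hb =>
      hsep a ha b (Finset.sdiff_subset hb)) with h | h
    · exact hsmall T (by exact_mod_cast h) hTc
    · exact hR T (by exact_mod_cast h) hTc

/-- A connected graph with at most `t` edges more than a spanning tree: delete one endpoint of each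
of these edges, and break the spanning tree. -/
lemma _root_.SimpleGraph.Connected.exists_breaking_set [Fintype V] (hG : G.Connected) (K t : ℕ)
    (ht : G.edgeSet.ncard < Fintype.card V + t) :
    ∃ R : Finset V, (K + 1) * R.card ≤ (K + 1) * t + Fintype.card V ∧
      ∀ T, Disjoint T R → (G.induce (T : Set V)).Connected → T.card ≤ K := by
  classical
  obtain ⟨F, hFG, hF⟩ := hG.exists_isTree_le
  obtain ⟨R₁, -, hR₁c, hR₁⟩ := hF.isAcyclic.exists_breaking_set K Finset.univ
  let E := G.edgeFinset \ F.edgeFinset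
  let R₂ := E.image fun e => (Quot.out e).1
  have hE : E.card ≤ t := by
    have h1 := hF.card_edgeFinset
    have h2 : E.card + F.edgeFinset.card = G.edgeFinset.card :=
      Finset.card_sdiff_add_card_eq_card (SimpleGraph.edgeFinset_subset_edgeFinset.2 hFG)
    rw [← SimpleGraph.coe_edgeFinset, Set.ncard_coe_finset] at ht
    omega
  refine ⟨R₁ ∪ R₂, ?_, ?_⟩
  · have h1 : R₂.card ≤ t := Finset.card_image_le.trans hE
    have h2 := Finset.card_union_le R₁ R₂
    rw [Finset.card_univ] at hR₁c
    calc (K + 1) * (R₁ ∪ R₂).card ≤ (K + 1) * (R₁.card + R₂.card) := by gcongr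
      _ ≤ (K + 1) * t + Fintype.card V := by nlinarith
  · intro T hT hTc
    rw [Finset.disjoint_union_right] at hT
    refine hR₁ T (by simpa [Finset.subset_sdiff] using hT.1) (hTc.mono ?_)
    rintro ⟨x, hx⟩ ⟨y, hy⟩ hxy
    change G.Adj x y at hxy
    change F.Adj x y
    by_contra hn
    have hmem : s(x, y) ∈ E := by simp [E, hxy, hn]
    have hout : (Quot.out s(x, y)).1 ∈ s(x, y) := Sym2.out_fst_mem _
    have hR : (Quot.out s(x, y)).1 ∈ R₂ := Finset.mem_image_of_mem _ hmem
    have hTx : (Quot.out s(x, y)).1 ∈ T := by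
      rcases Sym2.mem_iff.1 hout with h | h <;> rw [h] <;> assumption
    exact Finset.disjoint_left.1 hT.2 hTx hR

/-- No nonempty set of `k ≤ s` vertices spans `k + k / K + 1` or more edges: small sets are sparse
enough for every small connected subgraph to be nearly a tree. -/
def LocallySparse (G : SimpleGraph V) (K : ℕ) (s : ℝ) : Prop :=
  ∀ W : Finset V, W.Nonempty → (W.card : ℝ) ≤ s → ∀ F ⊆ W.sym2, (F : Set (Sym2 V)) ⊆ G.edgeSet →
    F.card < W.card + (W.card / K + 1)

lemma exists_breaking_set_of_connected {W : Finset V} (hW : (G.induce (W : Set V)).Connected)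
    (K t : ℕ)
    (ht : ∀ F ⊆ W.sym2, (F : Set (Sym2 V)) ⊆ G.edgeSet → F.card < W.card + t) :
    ∃ R ⊆ W, (K + 1) * R.card ≤ (K + 1) * t + W.card ∧
      ∀ T ⊆ W \ R, (G.induce (T : Set V)).Connected → T.card ≤ K := by
  classical
  have hcard : Fintype.card (W : Set V) = W.card := by simp
  have hedges : (G.induce (W : Set V)).edgeSet.ncard < Fintype.card (W : Set V) + t := by
    rw [hcard, ← SimpleGraph.coe_edgeFinset, Set.ncard_coe_finset]
    rw [← Finset.card_image_of_injective _ (Sym2.map.injective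
      (Subtype.val_injective (p := fun x => x ∈ (W : Set V))))]
    refine ht _ ?_ ?_
    · intro e he
      obtain ⟨e, -, rfl⟩ := Finset.mem_image.1 he
      induction e with
      | _ x y => simp
    · intro e he
      obtain ⟨e', he', rfl⟩ := Finset.mem_image.1 (Finset.mem_coe.1 he)
      clear he
      induction e' with
      | _ x y => simpa using he'
  obtain ⟨R, hRc, hR⟩ := hW.exists_breaking_set K t hedges
  refine ⟨R.map (Function.Embedding.subtype _), ?_, ?_, ?_⟩
  · intro x hx
    obtain ⟨y, -, rfl⟩ := Finset.mem_map.1 hx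
    exact y.2
  · rw [Finset.card_map]; omega
  · intro T hT hTc
    have hTW : ∀ x ∈ T, x ∈ (W : Set V) := fun x hx => by
      simpa using (Finset.mem_sdiff.1 (hT hx)).1
    have hTR : ∀ x (hx : x ∈ T), (⟨x, hTW x hx⟩ : (W : Set V)) ∉ R := fun x hx hxR =>
      (Finset.mem_sdiff.1 (hT hx)).2 (Finset.mem_map.2 ⟨_, hxR, rfl⟩)
    have hcardT : (T.subtype (· ∈ (W : Set V))).card = T.card := by
      rw [Finset.card_subtype, Finset.filter_true_of_mem hTW]
    rw [← hcardT]
    refine hR _ ?_ ?_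
    · rw [Finset.disjoint_left]
      rintro ⟨x, hxW⟩ hx
      exact hTR x (by simpa using hx)
    · let f : G.induce (T : Set V) →g
          (G.induce (W : Set V)).induce (T.subtype (· ∈ (W : Set V)) : Set (W : Set V)) :=
        { toFun := fun x => ⟨⟨x, hTW x x.2⟩, by simp⟩
          map_rel' := fun h => h }
      refine hTc.map f ?_
      rintro ⟨⟨x, hxW⟩, hx⟩
      exact ⟨⟨x, by simpa using hx⟩, rfl⟩

/-- In a locally sparse graph, a set whose pieces have at most `s` vertices loses at most a
fraction `3 / K` of its vertices when it is reduced to pieces with at most `K` vertices. -/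
lemma LocallySparse.exists_reduction {K : ℕ} {s : ℝ} (hG : LocallySparse G K s) (S : Finset V)
    (hS : ∀ T ⊆ S, (G.induce (T : Set V)).Connected → (T.card : ℝ) ≤ s) :
    ∃ R ⊆ S, K * R.card ≤ 3 * S.card ∧
      ∀ T ⊆ S \ R, (G.induce (T : Set V)).Connected → T.card ≤ K := by
  classical
  induction hk : S.card using Nat.strong_induction_on generalizing S with
  | _ k ih =>
  subst hk
  by_cases hbig : ∀ T ⊆ S, (G.induce (T : Set V)).Connected → T.card ≤ K
  · exact ⟨∅, by simp, by simp, fun T hT => hbig T (by simpa using hT)⟩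
  push Not at hbig
  obtain ⟨T₀, hT₀S, hT₀, hT₀K⟩ := hbig
  obtain ⟨W, hTW, hWS, hWc, hWsep⟩ := exists_component hT₀S hT₀
  have hWK : K < W.card := hT₀K.trans_le (Finset.card_le_card hTW)
  have hWne : W.Nonempty := Finset.card_pos.1 (by omega)
  obtain ⟨R₁, hR₁W, hR₁c, hR₁⟩ := exists_breaking_set_of_connected hWc K (W.card / K + 1)
    (hG W hWne (hS W hWS hWc))
  have hcard := Finset.card_sdiff_add_card_eq_card hWS
  obtain ⟨R₂, hR₂S, hR₂c, hR₂⟩ := ih (S \ W).card (by have := hWne.card_pos; omega) (S \ W)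
    (fun T hT => hS T (hT.trans Finset.sdiff_subset)) rfl
  refine ⟨R₁ ∪ R₂, Finset.union_subset (hR₁W.trans hWS) (hR₂S.trans Finset.sdiff_subset), ?_, ?_⟩
  · have h1 := Finset.card_union_le R₁ R₂
    have h2 := Nat.mul_div_le W.card K
    have h3 : K * R₁.card ≤ 3 * W.card := by
      by_contra! h
      have : (K + 1) * (K * R₁.card) ≤ (K + 1) * (K * (W.card / K) + K) + K * W.card := by
        calc _ = K * ((K + 1) * R₁.card) := by ring
          _ ≤ K * ((K + 1) * (W.card / K + 1) + W.card) := by gcongr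
          _ = _ := by ring
      have : (K + 1) * (K * (W.card / K) + K) ≤ (K + 1) * (W.card + W.card) := by gcongr
      nlinarith
    calc K * (R₁ ∪ R₂).card ≤ K * (R₁.card + R₂.card) := by gcongr
      _ ≤ 3 * S.card := by rw [mul_add]; omega
  · intro T hT hTc
    have hT' : (T : Set V) ⊆ (W \ R₁ : Finset V) ∪ ((S \ W) \ R₂ : Finset V) := by
      intro x hx
      have := hT hx
      simp only [Finset.mem_sdiff, Finset.mem_union, not_or] at this
      by_cases hxW : x ∈ W <;> simp [hxW, this]
    rcases subset_or_subset_of_preconnected hTc.preconnected hT' (fun a ha b hb =>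
      hWsep a (Finset.sdiff_subset ha) b (Finset.sdiff_subset hb)) with h | h
    · exact hR₁ T (by exact_mod_cast h) hTc
    · exact hR₂ T (by exact_mod_cast h) hTc

end Deterministic

/-! ### Components of induced subgraphs -/

section Components

lemma componentsAtMost_induce_iff {V : Type} {G : SimpleGraph V} {S : Finset V} {x : ℝ} :
    componentsAtMost x (S : Set V) (G.induce (S : Set V)) ↔
      ∀ T ⊆ S, (G.induce (T : Set V)).Connected → (T.card : ℝ) ≤ x := by
  classical
  constructor
  · intro h T hTS hT
    let f : G.induce (T : Set V) →g G.induce (S : Set V) :=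
      { toFun := fun y => ⟨y, hTS y.2⟩
        map_rel' := fun h => h }
    obtain ⟨v⟩ := hT.nonempty
    obtain ⟨hfin, hle⟩ := h ((G.induce (S : Set V)).connectedComponentMk (f v))
    refine le_trans ?_ hle
    rw [← Finset.card_attach, ← Set.ncard_coe_finset]
    refine Nat.cast_le.2 (Set.ncard_le_ncard_of_injOn (fun y => f y) ?_ ?_ hfin)
    · intro y _
      exact SimpleGraph.ConnectedComponent.sound ((hT.preconnected y v).map f)
    · intro y _ z _ hyz
      exact Subtype.ext (congrArg (fun w : (S : Set V) => (w : V)) hyz)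
  · intro h C
    have hfin : C.supp.Finite := Set.toFinite _
    refine ⟨hfin, ?_⟩
    let T : Finset V := hfin.toFinset.map (Function.Embedding.subtype _)
    have hT : T.card = C.supp.ncard := by
      rw [Finset.card_map, Set.ncard_eq_toFinset_card _ hfin]
    rw [← hT]
    refine h T ?_ ?_
    · intro y hy
      obtain ⟨z, -, rfl⟩ := Finset.mem_map.1 hy
      exact z.2
    · let f : C.toSimpleGraph →g G.induce (T : Set V) :=
        { toFun := fun y => ⟨(y.1 : V), Finset.mem_coe.2 (Finset.mem_map.2
            ⟨y.1, hfin.mem_toFinset.2 y.2, rfl⟩)⟩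
          map_rel' := fun h => h }
      refine C.connected_toSimpleGraph.map f ?_
      rintro ⟨y, hy⟩
      obtain ⟨z, hz, rfl⟩ := Finset.mem_map.1 (Finset.mem_coe.1 hy)
      exact ⟨⟨z, hfin.mem_toFinset.1 hz⟩, rfl⟩

lemma LocallySparse.nu_le {V : Type} [Fintype V] [DecidableEq V] {G : SimpleGraph V} {K : ℕ}
    {s x : ℝ} (hG : LocallySparse G K s) (hK : 0 < K) (hKx : (K : ℝ) ≤ x) :
    nu G (componentsAtMost s) ≤ nu G (componentsAtMost x) + 3 / K := by
  classical
  have hK' : (0 : ℝ) < K := by exact_mod_cast hK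
  have key : K * maxInduced G (componentsAtMost s) ≤
      K * maxInduced G (componentsAtMost x) + 3 * Fintype.card V := by
    unfold maxInduced
    rcases Finset.eq_empty_or_nonempty (Finset.univ.filter fun S : Finset V =>
      componentsAtMost s (S : Set V) (G.induce (S : Set V))) with h | h
    · rw [h]; simp
    · obtain ⟨S, hS, hSeq⟩ := Finset.exists_mem_eq_sup _ h Finset.card
      rw [hSeq]
      rw [Finset.mem_filter, componentsAtMost_induce_iff] at hS
      obtain ⟨R, hRS, hRc, hR⟩ := hG.exists_reduction S hS.2
      have h1 : (S \ R).card ≤ (Finset.univ.filter fun S : Finset V =>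
          componentsAtMost x (S : Set V) (G.induce (S : Set V))).sup Finset.card := by
        refine Finset.le_sup (f := Finset.card) (Finset.mem_filter.2 ⟨Finset.mem_univ _, ?_⟩)
        rw [componentsAtMost_induce_iff]
        exact fun T hT hTc => le_trans (by exact_mod_cast hR T hT hTc) hKx
      have h2 := Finset.card_sdiff_add_card_eq_card hRS
      have h3 := Finset.card_le_univ S
      calc K * S.card = K * (S \ R).card + K * R.card := by rw [← h2, mul_add]
        _ ≤ _ := Nat.add_le_add (Nat.mul_le_mul_left _ h1)
          (hRc.trans (Nat.mul_le_mul_left _ h3))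
  have key' : (K : ℝ) * maxInduced G (componentsAtMost s) ≤
      K * maxInduced G (componentsAtMost x) + 3 * Fintype.card V := by exact_mod_cast key
  unfold nu
  rcases (Fintype.card V).eq_zero_or_pos with h0 | h0
  · simp only [h0, Nat.cast_zero, div_zero, zero_add]; positivity
  · have h0' : (0 : ℝ) < Fintype.card V := by exact_mod_cast h0
    rw [div_add_div _ _ h0'.ne' hK'.ne', div_le_div_iff₀ h0' (by positivity)]
    nlinarith

end Components

/-! ### Local sparsity by the first moment method -/

section FirstMoment

open MeasureTheory

/-- Bound on the expected number of sets of `k` vertices that span `k + k / K + 1` edges: once `D`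
absorbs all factors exponential in `k`, the excess edges leave a power of `k / n` to beat it. -/
lemma choose_mul_choose_mul_pow_le {C D : ℝ} (hC : 1 ≤ C) {K n k : ℕ} (hK : 0 < K)
    (hD : D = (324 * C ^ 3) ^ K) (hk : 0 < k) (hkn : D * k ≤ n) (N : ℕ) (hN : N ≤ k ^ 2) :
    (n.choose k : ℝ) * (N.choose (k + (k / K + 1)) * (C / n) ^ (k + (k / K + 1))) ≤
      D / n * (1 / 2) ^ k := by
  have hD1 : 1 ≤ D := by rw [hD]; exact one_le_pow₀ (by nlinarith [one_le_pow₀ hC (n := 3)])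
  have hk' : (0 : ℝ) < k := by exact_mod_cast hk
  have hn' : (0 : ℝ) < n := by nlinarith
  obtain ⟨j, hj⟩ : ∃ j, j = k / K + 1 := ⟨_, rfl⟩
  obtain ⟨m, hm⟩ : ∃ m, m = k + j := ⟨_, rfl⟩
  rw [← hj, ← hm]
  have hkK : k ≤ K * j := by
    rw [hj]; have := Nat.div_add_mod k K; have := Nat.mod_lt k hK; rw [mul_add]; omega
  have hm3 : m ≤ 3 * k := by have := Nat.div_le_self k K; omega
  have hexp : ∀ i : ℕ, (i : ℝ) ^ i / (i.factorial : ℝ) ≤ 3 ^ i := fun i =>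
    calc (i : ℝ) ^ i / (i.factorial : ℝ) ≤ Real.exp i :=
          Real.pow_div_factorial_le_exp (i : ℝ) (Nat.cast_nonneg i) i
      _ = Real.exp 1 ^ i := by rw [← Real.exp_nat_mul, mul_one]
      _ ≤ 3 ^ i := pow_le_pow_left₀ (Real.exp_pos 1).le (by linarith [Real.exp_one_lt_d9]) i
  have h1 : (n.choose k : ℝ) ≤ (3 * (n / k)) ^ k := by
    calc (n.choose k : ℝ) ≤ (n : ℝ) ^ k / (k.factorial : ℝ) := Nat.choose_le_pow_div k n
      _ = (n / k : ℝ) ^ k * ((k : ℝ) ^ k / (k.factorial : ℝ)) := by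
          rw [div_pow]; field_simp
      _ ≤ (n / k : ℝ) ^ k * 3 ^ k := by gcongr; exact hexp k
      _ = _ := by rw [mul_pow, mul_comm]
  have h2 : (N.choose m : ℝ) ≤ (3 * k) ^ m := by
    calc (N.choose m : ℝ) ≤ (N : ℝ) ^ m / (m.factorial : ℝ) := Nat.choose_le_pow_div m N
      _ ≤ ((k : ℝ) * m) ^ m / (m.factorial : ℝ) := by
          gcongr
          have : (N : ℝ) ≤ (k : ℝ) ^ 2 := by exact_mod_cast hN
          have : (k : ℝ) ≤ m := by exact_mod_cast (by omega : k ≤ m)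
          nlinarith
      _ = (k : ℝ) ^ m * ((m : ℝ) ^ m / (m.factorial : ℝ)) := by rw [mul_pow]; ring
      _ ≤ (k : ℝ) ^ m * 3 ^ m := by gcongr; exact hexp m
      _ = _ := by rw [mul_pow, mul_comm]
  obtain ⟨y, hy⟩ : ∃ y : ℝ, y = k / n := ⟨_, rfl⟩
  have hy0 : 0 < y := by rw [hy]; positivity
  have hDy : D * y ≤ 1 := by rw [hy, ← mul_div_assoc, div_le_one hn']; exact hkn
  have hk2 : (k : ℝ) ≤ 2 ^ k := by exact_mod_cast Nat.lt_two_pow_self.le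
  calc (n.choose k : ℝ) * (N.choose m * (C / n) ^ m)
      ≤ (3 * (n / k)) ^ k * ((3 * k) ^ m * (C / n) ^ m) := by gcongr
    _ = 3 ^ k * (3 * C) ^ m * y ^ j := by
        rw [hm, hy, ← mul_pow]
        simp only [mul_pow, div_pow, pow_add]
        field_simp
    _ ≤ 3 ^ k * (3 * C) ^ (3 * k) * y ^ j := by
        gcongr
        linarith
    -- `324 * C ^ 3 = 4 * (3 * (3 * C) ^ 3)`; one half of the `4 ^ k` makes the series converge, the
    -- other absorbs the factor `k` of `y = k / n`
    _ = (324 * C ^ 3) ^ k * y ^ j * (1 / 4) ^ k := by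
        rw [pow_mul, ← mul_pow, mul_right_comm, ← mul_pow]
        congr 2
        ring
    _ ≤ ((324 * C ^ 3) ^ (K * j)) * y ^ j * (1 / 4) ^ k := by
        gcongr
        nlinarith [one_le_pow₀ hC (n := 3)]
    _ = (D * y) ^ j * (1 / 4) ^ k := by rw [pow_mul, ← hD, mul_pow]
    _ ≤ (D * y) ^ 1 * (1 / 4) ^ k := by
        gcongr ?_ * _
        exact pow_le_pow_of_le_one (by positivity) hDy (by rw [hj]; exact Nat.le_add_left 1 _)
    _ ≤ D / n * 2 ^ k * (1 / 4) ^ k := by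
        have hDk : D * y = D / n * k := by rw [hy]; ring
        rw [pow_one, hDk]
        gcongr
    _ = D / n * (1 / 2) ^ k := by
        rw [mul_assoc, ← mul_pow]; norm_num

/-- A random graph in which any given set of at most `n / 4` edges is present with probability at
most `(C / n) ^ |F|` is locally sparse, by the first moment method. -/
lemma measure_not_locallySparse_le {C D δ : ℝ} (hC : 1 ≤ C) {K n : ℕ} (hK : 0 < K) (hn : 0 < n)
    (hD : D = (324 * C ^ 3) ^ K) (hδ : δ * D ≤ 1) (μ : Measure (SimpleGraph (Fin n)))
    (hμ : ∀ F : Finset (Sym2 (Fin n)), 4 * F.card ≤ n →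
      μ {G | (F : Set (Sym2 (Fin n))) ⊆ G.edgeSet} ≤ ENNReal.ofReal ((C / n) ^ F.card)) :
    μ {G | ¬ LocallySparse G K (δ * n)} ≤ ENNReal.ofReal (2 * D / n) := by
  classical
  have hn' : (0 : ℝ) < n := by exact_mod_cast hn
  have hC3 : 1 ≤ C ^ 3 := one_le_pow₀ hC
  have hD324 : 324 ≤ D := by
    rw [hD]
    calc (324 : ℝ) ≤ (324 * C ^ 3) ^ 1 := by linarith
      _ ≤ _ := pow_le_pow_right₀ (by linarith) hK
  let m : ℕ → ℕ := fun k => k + (k / K + 1)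
  let Ws : Finset (Finset (Fin n)) :=
    Finset.univ.filter fun W => 0 < W.card ∧ D * W.card ≤ n
  have hsub : {G : SimpleGraph (Fin n) | ¬ LocallySparse G K (δ * n)} ⊆
      ⋃ W ∈ Ws, ⋃ F ∈ W.sym2.powersetCard (m W.card),
        {G | (F : Set (Sym2 (Fin n))) ⊆ G.edgeSet} := by
    intro G hG
    simp only [Set.mem_ofPred_eq, LocallySparse] at hG
    push Not at hG
    obtain ⟨W, hWne, hWδ, F, hFW, hFG, hFc⟩ := hG
    obtain ⟨F', hF'F, hF'c⟩ := Finset.exists_subset_card_eq hFc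
    simp only [Set.mem_iUnion]
    refine ⟨W, ?_, F', Finset.mem_powersetCard.2 ⟨hF'F.trans hFW, hF'c⟩,
      (Finset.coe_subset.2 hF'F).trans hFG⟩
    refine Finset.mem_filter.2 ⟨Finset.mem_univ _, hWne.card_pos, ?_⟩
    calc D * W.card ≤ D * (δ * n) := by gcongr
      _ = (δ * D) * n := by ring
      _ ≤ n := by nlinarith
  have hterm : ∀ W ∈ Ws, μ (⋃ F ∈ W.sym2.powersetCard (m W.card),
      {G | (F : Set (Sym2 (Fin n))) ⊆ G.edgeSet}) ≤
      ENNReal.ofReal (((W.card + 1).choose 2).choose (m W.card) * (C / n) ^ m W.card) := by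
    intro W hW
    obtain ⟨-, hW0, hWn⟩ := Finset.mem_filter.1 hW
    refine (measure_biUnion_finset_le _ _).trans ?_
    have hm4 : 4 * m W.card ≤ n := by
      have h1 : m W.card ≤ 3 * W.card := by
        have := Nat.div_le_self W.card K
        simp only [m]; omega
      have h2 : (12 * W.card : ℝ) ≤ n := by nlinarith
      have h3 : 12 * W.card ≤ n := by exact_mod_cast h2
      omega
    calc ∑ F ∈ W.sym2.powersetCard (m W.card), μ {G | (F : Set (Sym2 (Fin n))) ⊆ G.edgeSet}
        ≤ ∑ F ∈ W.sym2.powersetCard (m W.card), ENNReal.ofReal ((C / n) ^ m W.card) := by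
          refine Finset.sum_le_sum fun F hF => ?_
          have hFc := (Finset.mem_powersetCard.1 hF).2
          rw [← hFc]
          exact hμ F (by omega)
      _ = _ := by
          rw [Finset.sum_const, Finset.card_powersetCard, Finset.card_sym2, nsmul_eq_mul,
            ENNReal.ofReal_mul (by positivity), ENNReal.ofReal_natCast]
  let g : ℕ → ℝ := fun k => if 0 < k ∧ D * k ≤ n then
    ((k + 1).choose 2).choose (m k) * (C / n) ^ m k else 0
  have hg : ∀ k, 0 ≤ g k := fun k => by
    simp only [g]; split_ifs <;> positivity
  have hgk : ∀ k, (n.choose k : ℝ) * g k ≤ D / n * (1 / 2) ^ k := by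
    intro k
    by_cases hk : 0 < k ∧ D * k ≤ n
    · simp only [g, if_pos hk]
      refine choose_mul_choose_mul_pow_le hC hK hD hk.1 hk.2 _ ?_
      rw [Nat.choose_two_right, Nat.add_sub_cancel]
      apply Nat.div_le_of_le_mul
      nlinarith [hk.1]
    · simp only [g, if_neg hk, mul_zero]; positivity
  calc μ {G | ¬ LocallySparse G K (δ * n)}
      ≤ ∑ W ∈ Ws, ENNReal.ofReal (g W.card) := by
        refine (measure_mono hsub).trans ((measure_biUnion_finset_le _ _).trans ?_)
        refine Finset.sum_le_sum fun W hW => (hterm W hW).trans (le_of_eq ?_)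
        simp only [g]
        rw [if_pos (Finset.mem_filter.1 hW).2]
    _ ≤ ∑ W : Finset (Fin n), ENNReal.ofReal (g W.card) :=
        Finset.sum_le_sum_of_subset (Finset.subset_univ _)
    _ = ENNReal.ofReal (∑ k ∈ Finset.range (n + 1), (n.choose k : ℝ) * g k) := by
        rw [← ENNReal.ofReal_sum_of_nonneg fun _ _ => hg _, ← Finset.powerset_univ,
          Finset.sum_powerset_apply_card]
        simp [nsmul_eq_mul]
    _ ≤ ENNReal.ofReal (2 * D / n) := by
        refine ENNReal.ofReal_le_ofReal ?_
        calc ∑ k ∈ Finset.range (n + 1), (n.choose k : ℝ) * g k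
            ≤ ∑ k ∈ Finset.range (n + 1), D / n * (1 / 2) ^ k :=
              Finset.sum_le_sum fun k _ => hgk k
          _ = D / n * ∑ k ∈ Finset.range (n + 1), (1 / 2 : ℝ) ^ k := by rw [Finset.mul_sum]
          _ ≤ D / n * 2 := by gcongr; exact sum_geometric_two_le _
          _ = _ := by ring

end FirstMoment

/-! ### Edge probabilities in the binomial random graph -/

section Binomial

open MeasureTheory ProbabilityTheory unitInterval

lemma binomialRandom_subset_edgeSet_le {V : Type*} [Countable V] (p : I) (F : Finset (Sym2 V)) :
    SimpleGraph.binomialRandom V p {G | (F : Set (Sym2 V)) ⊆ G.edgeSet} ≤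
      ENNReal.ofReal ((p : ℝ) ^ F.card) := by
  classical
  rw [SimpleGraph.binomialRandom_apply']
  calc _ ≤ setBernoulli Sym2.diagSetᶜ p {s | (F : Set (Sym2 V)) ⊆ s} := by
        refine measure_mono ?_
        rintro _ ⟨G, hG, rfl⟩
        exact hG
    _ ≤ _ := by
        rw [setBernoulli_apply']
        have h1 : (fun q : Sym2 V → Prop => {i | q i}) ⁻¹' {s | (F : Set (Sym2 V)) ⊆ s} =
            Set.pi (F : Set (Sym2 V)) fun _ => {P : Prop | P} := rfl
        rw [h1, Measure.infinitePi_pi _ fun _ _ => MeasurableSet.of_discrete]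
        have h2 : ENNReal.ofReal ((p : ℝ) ^ F.card) = ∏ _i ∈ F, ENNReal.ofReal (p : ℝ) := by
          rw [Finset.prod_const, ENNReal.ofReal_pow p.2.1]
        rw [h2]
        refine Finset.prod_le_prod' fun e _ => ?_
        have h3 : ((toNNReal p : NNReal) : ENNReal) = ENNReal.ofReal (p : ℝ) := by
          rw [← ENNReal.ofReal_coe_nnreal]; rfl
        simp only [Measure.coe_add, Pi.add_apply, Measure.smul_apply]
        rw [Measure.dirac_apply' _ MeasurableSet.of_discrete,
          Measure.dirac_apply' _ MeasurableSet.of_discrete]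
        have h4 : Set.indicator {P : Prop | P} (1 : Prop → ENNReal) False = 0 := by simp
        rw [h4, smul_zero, add_zero, ← h3, ENNReal.smul_def, smul_eq_mul]
        refine mul_le_of_le_one_right' ?_
        exact Set.indicator_le_self' (fun _ _ => zero_le) _

lemma gnpLaw_subset_edgeSet_le {c : ℝ} (hc : 0 ≤ c) (n : ℕ) (F : Finset (Sym2 (Fin n))) :
    gnpLaw c n {G | (F : Set (Sym2 (Fin n))) ⊆ G.edgeSet} ≤ ENNReal.ofReal ((c / n) ^ F.card) := by
  refine (binomialRandom_subset_edgeSet_le _ F).trans (ENNReal.ofReal_le_ofReal ?_)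
  have hcn : 0 ≤ c / n := by positivity
  refine pow_le_pow_left₀ (Set.projIcc _ _ _ _).2.1 ?_ _
  rw [Set.coe_projIcc]
  exact max_le hcn (min_le_right _ _)

end Binomial

/-! ### Switchings of regular graphs -/

section Switching

variable {V : Type*} {G : SimpleGraph V} {u v x y : V}

/-- The switching of `G` that replaces the edges `uv` and `xy` by `ux` and `vy`. -/
def switching (G : SimpleGraph V) (u v x y : V) : SimpleGraph V :=
  SimpleGraph.fromEdgeSet ((G.edgeSet \ {s(u, v), s(x, y)}) ∪ {s(u, x), s(v, y)})

/-- The conditions under which replacing the edges `uv` and `xy` of `G` by `ux` and `vy` is a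
degree-preserving operation. They force the four vertices to be distinct. -/
structure Switchable (G : SimpleGraph V) (u v x y : V) : Prop where
  adj_left : G.Adj u v
  adj_right : G.Adj x y
  not_adj_fst : ¬ G.Adj u x
  not_adj_snd : ¬ G.Adj v y
  ne_fst : x ≠ u
  ne_snd : y ≠ v

lemma Switchable.switching_adj (h : Switchable G u v x y) (a b : V) :
    (switching G u v x y).Adj a b ↔
      (G.Adj a b ∧ s(a, b) ≠ s(u, v) ∧ s(a, b) ≠ s(x, y)) ∨ s(a, b) = s(u, x) ∨
        s(a, b) = s(v, y) := by
  obtain ⟨h1, h2, h3, h4, h5, h6⟩ := h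
  simp only [switching, SimpleGraph.fromEdgeSet_adj, Set.mem_union, Set.mem_sdiff,
    SimpleGraph.mem_edgeSet, Set.mem_insert_iff, Set.mem_singleton_iff, not_or]
  constructor
  · exact fun h => h.1
  · refine fun h => ⟨h, ?_⟩
    rintro rfl
    rcases h with h | h | h
    · exact h.1.ne rfl
    · grind [Sym2.eq_iff]
    · grind [Sym2.eq_iff]

lemma Switchable.ne_cross (h : Switchable G u v x y) : x ≠ v ∧ y ≠ u :=
  ⟨fun e => h.not_adj_fst (e ▸ h.adj_left), fun e => h.not_adj_snd (e ▸ h.adj_left.symm)⟩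

lemma Switchable.switching_switching (h : Switchable G u v x y) :
    switching (switching G u v x y) u x v y = G := by
  obtain ⟨h7, h8⟩ := h.ne_cross
  have h' : Switchable (switching G u v x y) u x v y := by
    have := h.switching_adj
    obtain ⟨h1, h2, h3, h4, h5, h6⟩ := h
    refine ⟨?_, ?_, ?_, ?_, h1.ne', h2.ne'⟩ <;> rw [this] <;> grind [Sym2.eq_iff]
  ext a b
  rw [h'.switching_adj, h.switching_adj]
  obtain ⟨h1, h2, h3, h4, h5, h6⟩ := h
  have := h1.symm
  have := h2.symm
  have h3' : ¬ G.Adj x u := fun h => h3 h.symm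
  have h4' : ¬ G.Adj y v := fun h => h4 h.symm
  constructor
  · grind [Sym2.eq_iff]
  · grind [Sym2.eq_iff]

lemma Switchable.ncard_neighborSet (h : Switchable G u v x y) (w : V) :
    ((switching G u v x y).neighborSet w).ncard = (G.neighborSet w).ncard := by
  obtain ⟨h7, h8⟩ := h.ne_cross
  have hadj := h.switching_adj
  obtain ⟨h1, h2, h3, h4, h5, h6⟩ := h
  have h1' := h1.symm
  have h2' := h2.symm
  have h3' : ¬ G.Adj x u := fun h => h3 h.symm
  have h4' : ¬ G.Adj y v := fun h => h4 h.symm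
  have huv := h1.ne
  have hxy := h2.ne
  by_cases hwu : w = u
  · subst hwu
    rw [← Set.ncard_exchange (s := G.neighborSet w) h3 h1]
    congr 1
    ext z
    simp only [SimpleGraph.mem_neighborSet, hadj, Set.mem_insert_iff, Set.mem_sdiff,
      Set.mem_singleton_iff, Sym2.eq_iff]
    grind
  by_cases hwv : w = v
  · subst hwv
    rw [← Set.ncard_exchange (s := G.neighborSet w) h4 h1']
    congr 1
    ext z
    simp only [SimpleGraph.mem_neighborSet, hadj, Set.mem_insert_iff, Set.mem_sdiff,
      Set.mem_singleton_iff, Sym2.eq_iff]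
    grind
  by_cases hwx : w = x
  · subst hwx
    rw [← Set.ncard_exchange (s := G.neighborSet w) h3' h2]
    congr 1
    ext z
    simp only [SimpleGraph.mem_neighborSet, hadj, Set.mem_insert_iff, Set.mem_sdiff,
      Set.mem_singleton_iff, Sym2.eq_iff]
    grind
  by_cases hwy : w = y
  · subst hwy
    rw [← Set.ncard_exchange (s := G.neighborSet w) h4' h2']
    congr 1
    ext z
    simp only [SimpleGraph.mem_neighborSet, hadj, Set.mem_insert_iff, Set.mem_sdiff,
      Set.mem_singleton_iff, Sym2.eq_iff]
    grind
  congr 1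
  ext z
  simp only [SimpleGraph.mem_neighborSet, hadj, Sym2.eq_iff]
  grind

variable [Fintype V]

open Classical in
lemma isRegularOfDegree_iff_ncard {d : ℕ} :
    G.IsRegularOfDegree d ↔ ∀ w, (G.neighborSet w).ncard = d := by
  refine forall_congr' fun w => ?_
  rw [← SimpleGraph.coe_neighborFinset, Set.ncard_coe_finset]
  rfl

open Classical in
/-- The `d`-regular graphs that contain the edge set `F`. -/
noncomputable def regularContaining (V : Type*) [Fintype V] (d : ℕ)
    (F : Finset (Sym2 V)) : Finset (SimpleGraph V) :=
  Finset.univ.filter fun G => G.IsRegularOfDegree d ∧ (F : Set (Sym2 V)) ⊆ G.edgeSet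

open Classical in
lemma mem_regularContaining {d : ℕ} {F : Finset (Sym2 V)} :
    G ∈ regularContaining V d F ↔ G.IsRegularOfDegree d ∧ (F : Set (Sym2 V)) ⊆ G.edgeSet := by
  simp [regularContaining]

variable [DecidableEq V]

open Classical in
/-- All but `2 d (d + 1) + 2 |F|` of the `|V| d` oriented edges `xy` of a `d`-regular graph can be
switched with a given edge `uv` without touching the edge set `F`. -/
lemma card_switchable_ge {d : ℕ} (hG : G.IsRegularOfDegree d) (huv : G.Adj u v)
    (F : Finset (Sym2 V)) :
    Fintype.card V * d ≤ (Finset.univ.filter fun p : V × V =>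
        Switchable G u v p.1 p.2 ∧ s(p.1, p.2) ∉ F).card + 2 * (d * (d + 1)) + 2 * F.card := by
  have hdeg : ∀ w, (G.neighborFinset w).card = d := fun w => hG w
  have hclosed : ∀ w, (insert w (G.neighborFinset w)).card = d + 1 := fun w => by
    rw [Finset.card_insert_of_notMem (by simp), hdeg]
  let D : Finset V → Finset (V × V) := fun M =>
    M.biUnion fun w => (G.neighborFinset w).image (Prod.mk w)
  have hD : ∀ M, (D M).card = M.card * d := by
    intro M
    rw [Finset.card_biUnion, Finset.sum_const_nat (m := d)]
    · intro w _; rw [Finset.card_image_of_injective _ (Prod.mk_right_injective w), hdeg]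
    · intro a _ b _ hab
      rw [Function.onFun, Finset.disjoint_left]
      intro p hp hq
      rw [Finset.mem_image] at hp hq
      obtain ⟨_, _, rfl⟩ := hp
      obtain ⟨_, _, h⟩ := hq
      exact hab (Prod.ext_iff.1 h).1.symm
  have hmem : ∀ M a b, (a, b) ∈ D M ↔ a ∈ M ∧ G.Adj a b := by
    intro M a b
    simp [D]
  -- the three reasons for an oriented edge `xy` not to qualify: `x` equals or is adjacent to `u`,
  -- `y` equals or is adjacent to `v`, or `xy` lies in `F`
  let X₁ := D (insert u (G.neighborFinset u))
  let X₂ := (D (insert v (G.neighborFinset v))).image Prod.swap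
  let X₃ := Finset.univ.filter fun p : V × V => s(p.1, p.2) ∈ F
  have h₁ : X₁.card = d * (d + 1) := by rw [hD, hclosed, mul_comm]
  have h₂ : X₂.card ≤ d * (d + 1) := by
    refine Finset.card_image_le.trans ?_
    rw [hD, hclosed, mul_comm]
  have h₃ : X₃.card ≤ 2 * F.card := by
    refine Finset.card_le_mul_card_image_of_maps_to (f := fun p : V × V => s(p.1, p.2))
      (fun p hp => (Finset.mem_filter.1 hp).2) 2 fun e _ => ?_
    induction e with
    | _ a b =>
      refine le_trans (Finset.card_le_card ?_) (Finset.card_le_two (a := (a, b)) (b := (b, a)))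
      rintro ⟨p, q⟩ hp
      have := (Finset.mem_filter.1 hp).2
      simp only [Sym2.eq_iff] at this
      simpa using this
  have hsub : D Finset.univ ⊆ (Finset.univ.filter fun p : V × V =>
      Switchable G u v p.1 p.2 ∧ s(p.1, p.2) ∉ F) ∪ X₁ ∪ X₂ ∪ X₃ := by
    rintro ⟨a, b⟩ hab
    rw [hmem] at hab
    by_contra hn
    simp only [Finset.mem_union, not_or] at hn
    obtain ⟨⟨⟨hn, hn₁⟩, hn₂⟩, hn₃⟩ := hn
    have hn₂' : (b, a) ∉ D (insert v (G.neighborFinset v)) := fun h =>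
      hn₂ (Finset.mem_image_of_mem Prod.swap h)
    simp only [X₁, hmem, Finset.mem_insert, SimpleGraph.mem_neighborFinset] at hn₁ hn₂'
    refine hn (Finset.mem_filter.2 ⟨Finset.mem_univ _, ⟨huv, hab.2, ?_, ?_, ?_, ?_⟩, ?_⟩)
    · exact fun h => hn₁ ⟨Or.inr h, hab.2⟩
    · exact fun h => hn₂' ⟨Or.inr h, hab.2.symm⟩
    · exact fun h => hn₁ ⟨Or.inl h, hab.2⟩
    · exact fun h => hn₂' ⟨Or.inl h, hab.2.symm⟩
    · exact fun h => hn₃ (Finset.mem_filter.2 ⟨Finset.mem_univ _, h⟩)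
  have h := Finset.card_le_card hsub
  rw [hD, Finset.card_univ] at h
  have h4 := Finset.card_union_le ((Finset.univ.filter fun p : V × V =>
      Switchable G u v p.1 p.2 ∧ s(p.1, p.2) ∉ F) ∪ X₁ ∪ X₂) X₃
  have h5 := Finset.card_union_le ((Finset.univ.filter fun p : V × V =>
      Switchable G u v p.1 p.2 ∧ s(p.1, p.2) ∉ F) ∪ X₁) X₂
  have h6 := Finset.card_union_le (Finset.univ.filter fun p : V × V =>
      Switchable G u v p.1 p.2 ∧ s(p.1, p.2) ∉ F) X₁
  omega

/-- Double counting of switchings: at most a fraction `2 d / |V|` of the `d`-regular graphs that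
contain `F` contain a further edge `uv`. -/
lemma card_regularContaining_insert_le {d : ℕ} (hd : 2 ≤ d) (hV : 8 * (d + 1) ≤ Fintype.card V)
    {F : Finset (Sym2 V)} (hF : 4 * F.card ≤ Fintype.card V) (e : Sym2 V) (he : e ∉ F) :
    (regularContaining V d (insert e F)).card * Fintype.card V ≤
      2 * d * (regularContaining V d F).card := by
  classical
  induction e with
  | _ u v =>
  let P : SimpleGraph V → Finset (V × V) := fun G => Finset.univ.filter fun p : V × V =>
    Switchable G u v p.1 p.2 ∧ s(p.1, p.2) ∉ F
  let Q : SimpleGraph V → Finset (V × V) := fun G => G.neighborFinset u ×ˢ G.neighborFinset v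
  have hA : ∀ G ∈ regularContaining V d (insert s(u, v) F),
      G.IsRegularOfDegree d ∧ G.Adj u v ∧ (F : Set (Sym2 V)) ⊆ G.edgeSet := by
    intro G hG
    simpa [mem_regularContaining, Set.insert_subset_iff, and_assoc] using hG
  have hP : ∀ G ∈ regularContaining V d (insert s(u, v) F),
      Fintype.card V * d ≤ 2 * (P G).card := by
    intro G hG
    obtain ⟨hreg, huv, -⟩ := hA G hG
    have h : Fintype.card V * d ≤ (P G).card + 2 * (d * (d + 1)) + 2 * F.card :=
      card_switchable_ge hreg huv F
    nlinarith
  have hQ : ∀ G ∈ regularContaining V d F, (Q G).card = d * d := by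
    intro G hG
    have hreg := (mem_regularContaining.1 hG).1
    rw [Finset.card_product]
    exact congrArg₂ _ (hreg u) (hreg v)
  have hinj : ((regularContaining V d (insert s(u, v) F)).sigma P).card ≤
      ((regularContaining V d F).sigma Q).card := by
    refine Finset.card_le_card_of_injOn (fun p => ⟨switching p.1 u v p.2.1 p.2.2, p.2⟩) ?_ ?_
    · rintro ⟨G, x, y⟩ hp
      obtain ⟨hG, hxy⟩ := Finset.mem_sigma.1 (Finset.mem_coe.1 hp)
      obtain ⟨hsw, hxyF⟩ := (Finset.mem_filter.1 hxy).2
      obtain ⟨hreg, -, hFG⟩ := hA G hG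
      simp only at hsw hxyF
      have hmem : switching G u v x y ∈ regularContaining V d F := by
        refine mem_regularContaining.2 ⟨?_, ?_⟩
        · rw [isRegularOfDegree_iff_ncard] at hreg ⊢
          exact fun w => (hsw.ncard_neighborSet w).trans (hreg w)
        · intro f hf
          have hfG := hFG hf
          induction f with
          | _ a b =>
            refine (hsw.switching_adj a b).2 (Or.inl ⟨hfG, ?_, ?_⟩)
            · intro h; rw [h] at hf; exact he hf
            · intro h; rw [h] at hf; exact hxyF hf
      have hux : (switching G u v x y).Adj u x := by simp [hsw.switching_adj]
      have hvy : (switching G u v x y).Adj v y := by simp [hsw.switching_adj]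
      have hQmem : (x, y) ∈ Q (switching G u v x y) := by simp [Q, hux, hvy]
      exact Finset.mem_coe.2 (Finset.mem_sigma.2 ⟨hmem, hQmem⟩)
    · rintro ⟨G₁, x, y⟩ hp₁ ⟨G₂, x', y'⟩ hp₂ heq
      obtain ⟨-, h₁⟩ := Finset.mem_sigma.1 (Finset.mem_coe.1 hp₁)
      obtain ⟨-, h₂⟩ := Finset.mem_sigma.1 (Finset.mem_coe.1 hp₂)
      have h₁ := (Finset.mem_filter.1 h₁).2.1
      have h₂ := (Finset.mem_filter.1 h₂).2.1
      simp only [Sigma.mk.injEq, heq_eq_eq, Prod.mk.injEq] at heq h₁ h₂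
      obtain ⟨hG, rfl, rfl⟩ := heq
      have : G₁ = G₂ := by
        rw [← h₁.switching_switching, hG, h₂.switching_switching]
      rw [this]
  rw [Finset.card_sigma, Finset.card_sigma, Finset.sum_congr rfl hQ, Finset.sum_const,
    smul_eq_mul] at hinj
  have hsum : (regularContaining V d (insert s(u, v) F)).card * (Fintype.card V * d) ≤
      2 * ∑ G ∈ regularContaining V d (insert s(u, v) F), (P G).card := by
    rw [Finset.mul_sum, ← smul_eq_mul, ← Finset.sum_const]
    exact Finset.sum_le_sum hP
  refine Nat.le_of_mul_le_mul_right ?_ (by omega : 0 < d)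
  nlinarith

lemma card_regularContaining_le {d : ℕ} (hd : 2 ≤ d) (hV : 8 * (d + 1) ≤ Fintype.card V)
    (F : Finset (Sym2 V)) (hF : 4 * F.card ≤ Fintype.card V) :
    (regularContaining V d F).card * Fintype.card V ^ F.card ≤
      (2 * d) ^ F.card * (regularContaining V d ∅).card := by
  induction F using Finset.induction_on with
  | empty => simp
  | insert e F he ih =>
    rw [Finset.card_insert_of_notMem he] at hF ⊢
    have h1 := ih (by omega)
    have h2 := card_regularContaining_insert_le hd hV (F := F) (by omega) e he
    calc (regularContaining V d (insert e F)).card * Fintype.card V ^ (F.card + 1)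
        = ((regularContaining V d (insert e F)).card * Fintype.card V) *
            Fintype.card V ^ F.card := by
          ring
      _ ≤ 2 * d * (regularContaining V d F).card * Fintype.card V ^ F.card := by gcongr
      _ = 2 * d * ((regularContaining V d F).card * Fintype.card V ^ F.card) := by ring
      _ ≤ 2 * d * ((2 * d) ^ F.card * (regularContaining V d ∅).card) := by gcongr
      _ = _ := by ring

end Switching

/-! ### The uniform random regular graph -/

section Regular

open MeasureTheory ProbabilityTheory

/-- The Cayley graph of a symmetric set `S` with `0 ∉ S` is `|S|`-regular. -/
lemma ncard_neighborSet_circulantGraph {A : Type*} [AddCommGroup A] {S : Set A}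
    (hS : ∀ a ∈ S, -a ∈ S) (h0 : (0 : A) ∉ S) (w : A) :
    ((SimpleGraph.circulantGraph S).neighborSet w).ncard = S.ncard := by
  rw [← Set.ncard_image_of_injective S (add_right_injective w)]
  congr 1
  ext z
  simp only [SimpleGraph.mem_neighborSet, SimpleGraph.circulantGraph, SimpleGraph.fromRel_adj,
    Set.mem_image]
  constructor
  · rintro ⟨-, h | h⟩
    · exact ⟨z - w, by simpa using hS _ h, by abel⟩
    · exact ⟨z - w, h, by abel⟩
  · rintro ⟨a, ha, rfl⟩
    refine ⟨fun h => h0 ?_, Or.inr (by simpa using ha)⟩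
    rwa [left_eq_add.1 h] at ha

/-- The connection set of a `d`-regular circulant graph: the `d / 2` smallest and the `d / 2` largest
nonzero residues mod `n`, and also `n / 2` if `d` is odd. -/
lemma exists_symmetric_subset {d n : ℕ} (hdn : d < n) (heven : Even (n * d)) :
    ∃ T ⊆ Finset.Ico 1 n, T.card = d ∧ ∀ t ∈ T, n - t ∈ T := by
  have hdisj : Disjoint (Finset.Ico 1 (d / 2 + 1)) (Finset.Ico (n - d / 2) n) := by
    rw [Finset.disjoint_left]; intro x; simp only [Finset.mem_Ico]; omega
  rcases Nat.even_or_odd' d with ⟨h, rfl | rfl⟩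
  · refine ⟨Finset.Ico 1 (h + 1) ∪ Finset.Ico (n - h) n, ?_, ?_, ?_⟩
    · intro x; simp only [Finset.mem_union, Finset.mem_Ico]; omega
    · rw [show 2 * h / 2 = h by omega] at hdisj
      rw [Finset.card_union_of_disjoint hdisj, Nat.card_Ico, Nat.card_Ico]; omega
    · intro x; simp only [Finset.mem_union, Finset.mem_Ico]; omega
  · obtain ⟨m, rfl⟩ : ∃ m, n = 2 * m := by
      rw [Nat.even_mul] at heven
      rcases heven with hn | hodd
      · exact hn.two_dvd
      · exact absurd hodd (by simp)
    refine ⟨insert m (Finset.Ico 1 (h + 1) ∪ Finset.Ico (2 * m - h) (2 * m)), ?_, ?_, ?_⟩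
    · intro x; simp only [Finset.mem_insert, Finset.mem_union, Finset.mem_Ico]; omega
    · rw [show (2 * h + 1) / 2 = h by omega] at hdisj
      rw [Finset.card_insert_of_notMem (by simp only [Finset.mem_union, Finset.mem_Ico]; omega),
        Finset.card_union_of_disjoint hdisj, Nat.card_Ico, Nat.card_Ico]
      omega
    · intro x; simp only [Finset.mem_insert, Finset.mem_union, Finset.mem_Ico]; omega

open Classical in
/-- A circulant graph shows that `d`-regular graphs exist. -/
lemma exists_isRegularOfDegree {d n : ℕ} (hdn : d < n) (heven : Even (n * d)) :
    ∃ G : SimpleGraph (Fin n), G.IsRegularOfDegree d := by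
  obtain ⟨T, hTn, hTd, hT⟩ := exists_symmetric_subset hdn heven
  have : NeZero n := ⟨by omega⟩
  have key : ∃ G : SimpleGraph (ZMod n), ∀ w, (G.neighborSet w).ncard = d := by
    refine ⟨SimpleGraph.circulantGraph ((fun t : ℕ => (t : ZMod n)) '' T), fun w => ?_⟩
    rw [ncard_neighborSet_circulantGraph, Set.InjOn.ncard_image, Set.ncard_coe_finset, hTd]
    · intro a ha b hb hab
      have ha' := Finset.mem_Ico.1 (hTn ha)
      have hb' := Finset.mem_Ico.1 (hTn hb)
      have := congrArg ZMod.val hab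
      simpa [ZMod.val_natCast, Nat.mod_eq_of_lt ha'.2, Nat.mod_eq_of_lt hb'.2] using this
    · rintro _ ⟨t, ht, rfl⟩
      have ht' := Finset.mem_Ico.1 (hTn ht)
      refine ⟨n - t, hT t ht, ?_⟩
      simp [Nat.cast_sub ht'.2.le]
    · rintro ⟨t, ht, h0⟩
      have ht' := Finset.mem_Ico.1 (hTn ht)
      have := (ZMod.natCast_eq_zero_iff t n).1 h0
      exact absurd (Nat.le_of_dvd (by omega) this) (by omega)
  cases n with
  | zero => omega
  | succ m =>
    obtain ⟨G, hG⟩ := key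
    -- `ZMod (m + 1)` is `Fin (m + 1)` by definition
    exact ⟨(G : SimpleGraph (Fin (m + 1))), isRegularOfDegree_iff_ncard.2 hG⟩

instance measurableSingletonClass_simpleGraph {V : Type*} [Countable V] :
    MeasurableSingletonClass (SimpleGraph V) where
  measurableSet_singleton G := by
    have h : ({G} : Set (SimpleGraph V)) = SimpleGraph.edgeSet ⁻¹' {G.edgeSet} := by
      ext H; simp
    rw [h]
    exact SimpleGraph.measurable_edgeSet (MeasurableSet.singleton _)

lemma isProbabilityMeasure_regularLaw {d n : ℕ} (hdn : d < n) (heven : Even (n * d)) :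
    IsProbabilityMeasure (regularLaw d n) :=
  isProbabilityMeasure_uniformOn (Set.toFinite _) (exists_isRegularOfDegree hdn heven)

lemma regularLaw_subset_edgeSet_le {d n : ℕ} (hd : 2 ≤ d) (hn : 8 * (d + 1) ≤ n)
    (F : Finset (Sym2 (Fin n))) (hF : 4 * F.card ≤ n) :
    regularLaw d n {G | (F : Set (Sym2 (Fin n))) ⊆ G.edgeSet} ≤
      ENNReal.ofReal (((2 * d : ℝ) / n) ^ F.card) := by
  classical
  have hn0 : 0 < n := by omega
  have h := card_regularContaining_le (V := Fin n) hd (by simpa using hn) F (by simpa using hF)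
  rw [Fintype.card_fin] at h
  have h1 : {G : SimpleGraph (Fin n) | G.IsRegularOfDegree d} =
      (regularContaining (Fin n) d ∅ : Set (SimpleGraph (Fin n))) := by
    ext G; simp [regularContaining]
  have h2 : {G : SimpleGraph (Fin n) | (F : Set (Sym2 (Fin n))) ⊆ G.edgeSet} =
      ((Finset.univ.filter fun G : SimpleGraph (Fin n) => (F : Set (Sym2 (Fin n))) ⊆ G.edgeSet :
        Finset (SimpleGraph (Fin n))) : Set (SimpleGraph (Fin n))) := by
    ext G; simp
  have h3 : regularContaining (Fin n) d ∅ ∩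
      (Finset.univ.filter fun G : SimpleGraph (Fin n) => (F : Set (Sym2 (Fin n))) ⊆ G.edgeSet) =
      regularContaining (Fin n) d F := by
    ext G; simp [regularContaining]
  have h4 : regularLaw d n {G | (F : Set (Sym2 (Fin n))) ⊆ G.edgeSet} =
      (regularContaining (Fin n) d F).card / (regularContaining (Fin n) d ∅).card := by
    rw [← h3, ← uniformOn_apply_finset, ← h2, ← h1, regularLaw]
  rw [h4]
  refine ENNReal.div_le_of_le_mul ?_
  rw [← ENNReal.ofReal_natCast, ← ENNReal.ofReal_natCast, ← ENNReal.ofReal_mul (by positivity)]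
  refine ENNReal.ofReal_le_ofReal ?_
  rw [div_pow, div_mul_eq_mul_div, le_div_iff₀ (by positivity)]
  exact_mod_cast h

end Regular

/-! ### Passage to the limit -/

section Limit

open MeasureTheory Filter

lemma LocallySparse.mem_goodGraphs {K n : ℕ} {δ ε : ℝ} (hε : 0 < ε) (hK : 3 / ε ≤ K)
    (hδ : 0 < δ) (hδK : δ * K ≤ 1) {G : SimpleGraph (Fin n)} (hG : LocallySparse G K (δ * n)) :
    G ∈ goodGraphs δ ε n := by
  have hK0 : (0 : ℝ) < K := (by positivity : (0 : ℝ) < 3 / ε).trans_le hK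
  have h := hG.nu_le (x := 1 / δ) (by exact_mod_cast hK0)
    (by rw [le_div_iff₀ hδ]; linarith)
  have h3 : 3 / (K : ℝ) ≤ ε := by rw [div_le_iff₀ hK0]; rw [div_le_iff₀ hε] at hK; linarith
  change nu G _ ≤ nu G _ + ε
  linarith

lemma tendsto_measure_goodGraphs {C δ ε : ℝ} {K : ℕ} (hC : 1 ≤ C) (hε : 0 < ε) (hK : 3 / ε ≤ K)
    (hδ : 0 < δ) (hδK : δ * K ≤ 1) (hδC : δ * (324 * C ^ 3) ^ K ≤ 1) {l : Filter ℕ}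
    (hl : l ≤ atTop) (μ : ∀ n, Measure (SimpleGraph (Fin n)))
    (hprob : ∀ᶠ n in l, IsProbabilityMeasure (μ n))
    (hμ : ∀ᶠ n in l, ∀ F : Finset (Sym2 (Fin n)), 4 * F.card ≤ n →
      μ n {G | (F : Set (Sym2 (Fin n))) ⊆ G.edgeSet} ≤ ENNReal.ofReal ((C / n) ^ F.card)) :
    Tendsto (fun n => μ n (goodGraphs δ ε n)) l (nhds 1) := by
  have hK0 : 0 < K := by
    have : (0 : ℝ) < K := (by positivity : (0 : ℝ) < 3 / ε).trans_le hK
    exact_mod_cast this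
  have h0 : Tendsto (fun n : ℕ => 1 - ENNReal.ofReal (2 * (324 * C ^ 3) ^ K / n)) l (nhds 1) := by
    have h1 := ENNReal.tendsto_ofReal
      ((tendsto_const_div_atTop_nhds_zero_nat (2 * (324 * C ^ 3) ^ K)).mono_left hl)
    rw [ENNReal.ofReal_zero] at h1
    simpa using ENNReal.Tendsto.sub tendsto_const_nhds h1 (Or.inl ENNReal.one_ne_top)
  refine tendsto_of_tendsto_of_tendsto_of_le_of_le' h0 tendsto_const_nhds ?_ ?_
  · filter_upwards [hprob, hμ, hl (eventually_gt_atTop 0)] with n hp hμn hn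
    have hbad := measure_not_locallySparse_le hC hK0 hn rfl hδC (μ n) hμn
    have hcover : (Set.univ : Set (SimpleGraph (Fin n))) ⊆
        goodGraphs δ ε n ∪ {G | ¬ LocallySparse G K (δ * n)} := by
      intro G _
      by_cases hG : LocallySparse G K (δ * n)
      · exact Or.inl (hG.mem_goodGraphs hε hK hδ hδK)
      · exact Or.inr hG
    rw [tsub_le_iff_right]
    calc 1 = μ n Set.univ := measure_univ.symm
      _ ≤ _ := measure_mono hcover
      _ ≤ _ := measure_union_le _ _
      _ ≤ _ := by gcongr
  · filter_upwards [hprob] with n hp using prob_le_one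

end Limit

end Dismantling

theorem theorem1 (c : ℝ) (hc : 1 < c) (d : ℕ) (hd : 3 ≤ d) (ε : ℝ) (hε : 0 < ε) :
    ∃ δ : ℝ, 0 < δ ∧
      Filter.Tendsto (fun n : ℕ => Dismantling.gnpLaw c n (Dismantling.goodGraphs δ ε n))
        Filter.atTop (nhds 1) ∧
      Filter.Tendsto (fun n : ℕ => Dismantling.regularLaw d n (Dismantling.goodGraphs δ ε n))
        (Filter.atTop ⊓ Filter.principal {n : ℕ | Even (n * d)}) (nhds 1) := by
  have hd' : (3 : ℝ) ≤ d := by exact_mod_cast hd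
  obtain ⟨K, hK⟩ := exists_nat_ge (3 / ε)
  have hK0 : (0 : ℝ) < K := (by positivity : (0 : ℝ) < 3 / ε).trans_le hK
  -- one constant that bounds the edge probabilities of both models
  obtain ⟨C, hC⟩ : ∃ C : ℝ, C = c + 2 * d := ⟨_, rfl⟩
  have hC1 : 1 ≤ C := by linarith
  have hD : (0 : ℝ) < (324 * C ^ 3) ^ K := by positivity
  have hδ : 0 < 1 / (K + (324 * C ^ 3) ^ K) := by positivity
  have hδK : 1 / (K + (324 * C ^ 3) ^ K) * K ≤ 1 := by
    rw [div_mul_eq_mul_div, div_le_one (by positivity)]; linarith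
  have hδC : 1 / (K + (324 * C ^ 3) ^ K) * (324 * C ^ 3) ^ K ≤ 1 := by
    rw [div_mul_eq_mul_div, div_le_one (by positivity)]; linarith
  refine ⟨1 / (K + (324 * C ^ 3) ^ K), hδ, ?_, ?_⟩
  · refine Dismantling.tendsto_measure_goodGraphs hC1 hε hK hδ hδK hδC le_rfl _
      (Filter.Eventually.of_forall fun n => ?_) (Filter.Eventually.of_forall fun n F _ => ?_)
    · unfold Dismantling.gnpLaw
      infer_instance
    · refine (Dismantling.gnpLaw_subset_edgeSet_le (by linarith) n F).trans
        (ENNReal.ofReal_le_ofReal ?_)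
      have : c ≤ C := by linarith
      gcongr
  · have hlarge : ∀ᶠ n in Filter.atTop ⊓ Filter.principal {n : ℕ | Even (n * d)},
        8 * (d + 1) ≤ n ∧ Even (n * d) :=
      (Filter.Eventually.filter_mono inf_le_left (Filter.eventually_ge_atTop _)).and
        (Filter.Eventually.filter_mono inf_le_right (Filter.mem_principal_self _))
    refine Dismantling.tendsto_measure_goodGraphs hC1 hε hK hδ hδK hδC inf_le_left _ ?_ ?_
    · filter_upwards [hlarge] with n hn
      exact Dismantling.isProbabilityMeasure_regularLaw (by omega) hn.2
    · filter_upwards [hlarge] with n hn F hF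
      refine (Dismantling.regularLaw_subset_edgeSet_le (by omega) hn.1 F hF).trans
        (ENNReal.ofReal_le_ofReal ?_)
      have : 2 * (d : ℝ) ≤ C := by linarith
      gcongr
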